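/- Let $d\ge 1$, let $S$ be a finite set, and let $\Omega=S^{\mathbb Z^d}$ carry the product $\sigma$-algebra $\mathfrak B$ and the shifts $(\theta_x\omega)_y=\omega_{y-x}$, $x,y\in\mathbb Z^d$. A shift-invariant probability measure on $\Omega$ is ergodic if every $A\in\mathfrak B$ with $\theta_xA=A$ for all $x\in\mathbb Z^d$ has measure $0$ or $1$. Let $\Phi$ be a shift-invariant, uniformly summable potential, that is, a family of functions $\Phi(\Lambda,\cdot):\Omega\to\mathbb R$, indexed by the nonempty finite $\Lambda\subset\mathbb Z^d$, such that $\Phi(\Lambda,\omega)$ depends only on $\omega_\Lambda$, $\Phi(\Lambda+x,\theta_x\omega)=\Phi(\Lambda,\omega)$ for all $x\in\mathbb Z^d$ and $\omega\in\Omega$, and $\sum_{\Lambda\ni 0}\|\Phi(\Lambda,\cdot)\|_\infty<\infty$. For finite $\Lambda\subset\mathbb Z^d$ put $$\mathcal H_\Lambda(\omega|\eta)=\sum_{\Lambda'\cap\Lambda\neq\emptyset}\Phi(\Lambda',\omega_\Lambda\eta_{\Lambda^c}),\qquad \gamma_\Lambda(\omega|\eta)=\frac{e^{-\mathcal H_\Lambda(\omega|\eta)}}{\sum_{\omega'\in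 S^\Lambda}e^{-\mathcal H_\Lambda(\omega'|\eta)}}\qquad(\omega\in S^\Lambda,\ \eta\in\Omega).$$ A probability measure $\mu$ on $\Omega$ is a Gibbs measure for $\Phi$ if for all finite $\Lambda\subset\mathbb Z^d$ and all $A\in\mathfrak B$ $$\mu(A)=\int\sum_{\omega'\in S^\Lambda}\gamma_\Lambda(\omega'|\eta)\,\mathbf 1_A(\omega'_\Lambda\eta_{\Lambda^c})\,d\mu(\eta).$$ Let $\Lambda_n=[-n,n]^d\cap\mathbb Z^d$, and for shift-invariant probability measures $\nu,\mu$ let $H_n(\nu|\mu)$ be the relative entropy (Kullback--Leibler divergence) of the marginal of $\nu$ on $S^{\Lambda_n}$ with respect to that of $\mu$, and $h(\nu|\mu)=\lim_{n\to\infty}(2n+1)^{-d}H_n(\nu|\mu)$ when the limit exists. A shift-invariant probability measure $\nu$ is an equilibrium state for $\Phi$ if $h(\nu|\Phi)=0$, where $h(\nu|\Phi):=h(\nu|\mu)$ for a shift-invariant Gibbs measure $\mu$ for $\Phi$ (such a $\mu$ exists, and the limit exists and does not depend on $\mu$). A probability measure $\mu$ on $\Omega$ satisfies a Gaussian concentration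 bound (GCB) if there is a constant $D>0$ such that for every function $F:\Omega\to\mathbb R$ that depends on only finitely many coordinates $$\int e^{F-\int F\,d\mu}\,d\mu\le \exp\Big(D\sum_{x\in\mathbb Z^d}\delta_x(F)^2\Big),$$ where $\delta_x(F)$ is the supremum of $|F(\omega)-F(\omega')|$ over all $\omega,\omega'\in\Omega$ that differ only at $x$. Then: 1. If there are at least two distinct ergodic Gibbs measures for $\Phi$, then no ergodic Gibbs measure for $\Phi$ satisfies GCB. 2. If there are at least two distinct ergodic equilibrium states for $\Phi$, then no ergodic equilibrium state for $\Phi$ satisfies GCB. 3. If an ergodic equilibrium state for $\Phi$ satisfies GCB, then it is the unique equilibrium state for $\Phi$. -/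

import Mathlib

open MeasureTheory Filter Topology
open scoped ENNReal

namespace LatticeGibbs

noncomputable section

/-- The sites of the lattice `ℤ^d`. -/
abbrev Site (d : ℕ) : Type := Fin d → ℤ

/-- The configuration space `Ω = S^{ℤ^d}`, with the product σ-algebra. -/
abbrev Config (d : ℕ) (S : Type*) : Type _ := Site d → S

/-- The shift `(θ_x ω)_y = ω_{y - x}`. -/
def shift {d : ℕ} {S : Type*} (x : Site d) (ω : Config d S) : Config d S :=
  fun y => ω (y - x)

/-- The centered cube `Λ_n = {x : -n ≤ x_i ≤ n for all i}`. -/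
def box (d n : ℕ) : Finset (Site d) :=
  Finset.Icc (fun _ => -(n : ℤ)) (fun _ => (n : ℤ))

/-- The configuration that agrees with the pattern `p` on `Λ` and with `η` off `Λ`. -/
def glue {d : ℕ} {S : Type*} (Λ : Finset (Site d)) (p : Λ → S) (η : Config d S) :
    Config d S :=
  fun x => if h : x ∈ Λ then p ⟨x, h⟩ else η x

/-! ### Shift-invariant and ergodic probability measures -/

/-- `μ` is a shift-invariant probability measure on `Ω`. -/
structure IsShiftInvariant {d : ℕ} {S : Type*} [MeasurableSpace S]
    (μ : Measure (Config d S)) : Prop where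
  isProbabilityMeasure : IsProbabilityMeasure μ
  map_shift : ∀ x : Site d, μ.map (shift x) = μ

/-- `μ` is an ergodic probability measure: it is shift-invariant, and trivial on the
σ-algebra of the events that are invariant under all shifts. -/
structure IsErgodic {d : ℕ} {S : Type*} [MeasurableSpace S]
    (μ : Measure (Config d S)) : Prop where
  isShiftInvariant : IsShiftInvariant μ
  trivial_of_invariant : ∀ A : Set (Config d S), MeasurableSet A →
    (∀ x : Site d, shift x '' A = A) → μ A = 0 ∨ μ A = 1

/-! ### The Gaussian concentration bound -/

/-- The local functions: those that depend on finitely many coordinates. -/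
def IsLocal {d : ℕ} {S : Type*} (F : Config d S → ℝ) : Prop :=
  ∃ Λ : Finset (Site d), DependsOn F (Λ : Set (Site d))

/-- The oscillation `δ_x(F)` of `F` at the site `x`: the supremum of `|F ω - F ω'|` over the
configurations `ω`, `ω'` that differ at most at `x`. -/
def oscillation {d : ℕ} {S : Type*} (F : Config d S → ℝ) (x : Site d) : ℝ :=
  sSup {r : ℝ | ∃ ω ω' : Config d S, (∀ y, y ≠ x → ω y = ω' y) ∧ r = |F ω - F ω'|}

/-- The Gaussian concentration bound: there is a constant `D > 0` such that
`E_μ[exp (F - E_μ F)] ≤ exp (D * ∑_x δ_x(F)^2)` for all local functions `F`. -/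
def GCB {d : ℕ} {S : Type*} [MeasurableSpace S] (μ : Measure (Config d S)) : Prop :=
  ∃ D : ℝ, 0 < D ∧ ∀ F : Config d S → ℝ, IsLocal F →
    ∫ ω, Real.exp (F ω - ∫ ω', F ω' ∂μ) ∂μ ≤ Real.exp (D * ∑' x : Site d, oscillation F x ^ 2)

/-! ### Potentials and Gibbs measures -/

/-- A potential: for each nonempty finite `Λ ⊆ ℤ^d` a function on `Ω` that depends only on the
coordinates in `Λ`. The value at `Λ = ∅` is never used. -/
structure Potential (d : ℕ) (S : Type*) where
  toFun : Finset (Site d) → Config d S → ℝ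
  dependsOn : ∀ Λ : Finset (Site d), Λ.Nonempty → DependsOn (toFun Λ) (Λ : Set (Site d))

namespace Potential

variable {d : ℕ} {S : Type*}

/-- Shift-invariance: `Φ(Λ + x, θ_x ω) = Φ(Λ, ω)`. -/
def ShiftInvariant (Φ : Potential d S) : Prop :=
  ∀ (Λ : Finset (Site d)) (ω : Config d S) (x : Site d), Λ.Nonempty →
    Φ.toFun (Λ.map (addRightEmbedding x)) (shift x ω) = Φ.toFun Λ ω

/-- Uniform summability: `∑_{Λ ∋ 0} ‖Φ(Λ, ·)‖_∞ < ∞`. -/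
def UniformlySummable (Φ : Potential d S) : Prop :=
  Summable fun Λ : {Λ : Finset (Site d) // 0 ∈ Λ} => ⨆ ω : Config d S, |Φ.toFun Λ.1 ω|

/-- The Hamiltonian `H_Λ(p | η)` in `Λ` with boundary condition `η`: the sum of
`Φ(Λ', p_Λ η_{Λᶜ})` over all finite `Λ'` that meet `Λ`. -/
def hamiltonian (Φ : Potential d S) (Λ : Finset (Site d)) (p : Λ → S) (η : Config d S) : ℝ :=
  ∑' Λ' : {Λ' : Finset (Site d) // (Λ' ∩ Λ).Nonempty}, Φ.toFun Λ'.1 (glue Λ p η)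

/-- The partition function `Z_Λ(η)`. -/
def partitionFunction [Fintype S] (Φ : Potential d S) (Λ : Finset (Site d))
    (η : Config d S) : ℝ :=
  ∑ p : Λ → S, Real.exp (-Φ.hamiltonian Λ p η)

/-- The Gibbsian specification `γ_Λ(p | η)`. -/
def specification [Fintype S] (Φ : Potential d S) (Λ : Finset (Site d)) (p : Λ → S)
    (η : Config d S) : ℝ :=
  Real.exp (-Φ.hamiltonian Λ p η) / Φ.partitionFunction Λ η

/-- `μ` is a Gibbs measure for `Φ`: a probability measure that satisfies the DLR equations. -/
structure IsGibbs [Fintype S] [MeasurableSpace S] (Φ : Potential d S)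
    (μ : Measure (Config d S)) : Prop where
  isProbabilityMeasure : IsProbabilityMeasure μ
  dlr : ∀ (Λ : Finset (Site d)) (A : Set (Config d S)), MeasurableSet A →
    μ A = ∫⁻ η, ∑ p : Λ → S,
      ENNReal.ofReal (Φ.specification Λ p η) *
        A.indicator (fun _ => (1 : ℝ≥0∞)) (glue Λ p η) ∂μ

end Potential

/-! ### Relative entropy and equilibrium states -/

/-- `H_n(ν | μ)`, the relative entropy (Kullback–Leibler divergence) of the marginal of `ν` on
`S^{Λ_n}` with respect to the marginal of `μ`. -/
def relEntropy {d : ℕ} {S : Type*} [MeasurableSpace S] (n : ℕ)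
    (ν μ : Measure (Config d S)) : ℝ≥0∞ :=
  InformationTheory.klDiv (ν.map (box d n).restrict) (μ.map (box d n).restrict)

/-- The limit `h(ν | μ) = lim_n H_n(ν | μ) / (2n+1)^d` exists and equals `h`. -/
def HasSpecificRelEntropy {d : ℕ} {S : Type*} [MeasurableSpace S]
    (ν μ : Measure (Config d S)) (h : ℝ≥0∞) : Prop :=
  Tendsto (fun n : ℕ => relEntropy n ν μ / ((2 * n + 1) ^ d : ℕ)) atTop (𝓝 h)

namespace Potential

variable {d : ℕ} {S : Type*} [Fintype S] [MeasurableSpace S]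

/-- `ν` is an equilibrium state for `Φ`: a shift-invariant probability measure with
`h(ν | Φ) = 0`, where `h(ν | Φ) = h(ν | μ)` for a shift-invariant Gibbs measure `μ` for `Φ`. -/
def IsEquilibriumState (Φ : Potential d S) (ν : Measure (Config d S)) : Prop :=
  IsShiftInvariant ν ∧
    ∃ μ : Measure (Config d S), Φ.IsGibbs μ ∧ IsShiftInvariant μ ∧ HasSpecificRelEntropy ν μ 0

/-- The set of the ergodic Gibbs measures for `Φ`. -/
def ergodicGibbs (Φ : Potential d S) : Set (Measure (Config d S)) :=
  {μ | Φ.IsGibbs μ ∧ IsErgodic μ}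

/-- The set of the equilibrium states for `Φ`. -/
def equilibriumStates (Φ : Potential d S) : Set (Measure (Config d S)) :=
  {μ | Φ.IsEquilibriumState μ}

/-- The set of the ergodic equilibrium states for `Φ`. -/
def ergodicEquilibriumStates (Φ : Potential d S) : Set (Measure (Config d S)) :=
  {μ | Φ.IsEquilibriumState μ ∧ IsErgodic μ}

end Potential

end

end LatticeGibbs

/-! Everything reduces to one uniqueness statement (`IsGibbs.eq_of_gcb`): a shift-invariant Gibbs
measure `μ` with GCB equals every shift-invariant Gibbs measure `ν`.

Suppose `ν E - μ E = a > 0` for a cylinder event `E`, and let `F` be `t` times the sum of the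
translates of `1_E` over a large box with `N` sites. Jensen's inequality gives `exp (ν F) ≤ ν (exp
F)`. Two Gibbs measures agree on a box up to a factor `exp (o(N))` (`IsGibbs.integral_le_exp_mul`,
`eventually_sum_tail_box_le`), because the boundary condition changes the energy only by a boundary
term. GCB bounds `μ (exp F)` by `exp (μ F + O(t² N))`, since each site is seen by boundedly many
translates. Hence `t a N ≤ o(N) + O(t² N)`, which fails for small `t` and large `N`.

To apply this to equilibrium states one needs that they are Gibbs
(`IsGibbs.of_hasSpecificRelEntropy_zero`). If `ν` violates a DLR equation, some local observable has
a strictly larger mean under `ν` than its conditional means under `μ`. Summing it over well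
separated translates, bounding its exponential moment under `μ` by successive resampling, and
inserting the sum into the Donsker–Varadhan inequality yields relative entropy of positive density.

Conversely, a shift-invariant Gibbs measure is an equilibrium state, as `h(μ|μ) = 0`. So the third
assertion gives the second, and the second gives the first. -/

namespace LatticeGibbs

/-! ### Local functions and cylinder events -/

section Local

variable {d : ℕ} {S : Type*}

theorem glue_of_mem {Λ : Finset (Site d)} {p : Λ → S} {η : Config d S} {x : Site d}
    (h : x ∈ Λ) : glue Λ p η x = p ⟨x, h⟩ := by simp [glue, h]

theorem glue_of_notMem {Λ : Finset (Site d)} {p : Λ → S} {η : Config d S} {x : Site d}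
    (h : x ∉ Λ) : glue Λ p η x = η x := by simp [glue, h]

theorem shift_surjective (x : Site d) : Function.Surjective (shift (S := S) x) := fun ω =>
  ⟨fun y => ω (y + x), funext fun y => by simp [shift]⟩

theorem glue_congr {Λ : Finset (Site d)} {p : Λ → S} {η η' : Config d S} {x : Site d}
    (h : η x = η' x) : glue Λ p η x = glue Λ p η' x := by
  simp only [glue]; split_ifs <;> simp [h]

theorem _root_.DependsOn.comp_glue_eq {α : Type*} {F : Config d S → α} {Λ : Finset (Site d)}
    (hF : DependsOn F (Λ : Set (Site d))) (p : Λ → S) (η η' : Config d S) :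
    F (glue Λ p η) = F (glue Λ p η') :=
  hF fun x hx => by rw [glue_of_mem hx, glue_of_mem hx]

theorem _root_.DependsOn.apply_glue_restrict {α : Type*} {F : Config d S → α} {Λ : Finset (Site d)}
    (hF : DependsOn F (Λ : Set (Site d))) (ω η : Config d S) :
    F (glue Λ (Λ.restrict ω) η) = F ω :=
  hF fun x hx => by rw [glue_of_mem hx]; rfl

theorem _root_.DependsOn.comp_shift {α : Type*} {F : Config d S → α} {Λ : Set (Site d)}
    (hF : DependsOn F Λ) {M : Set (Site d)} (x : Site d) (h : ∀ y ∈ Λ, y - x ∈ M) :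
    DependsOn (fun ω => F (shift x ω)) M := fun _ _ hω =>
  hF fun y hy => hω _ (h y hy)

theorem _root_.DependsOn.finset_sum {ι : Type*} {F : ι → Config d S → ℝ} {Z : Finset ι}
    {M : Set (Site d)} (h : ∀ i ∈ Z, DependsOn (F i) M) :
    DependsOn (fun ω => ∑ i ∈ Z, F i ω) M := fun _ _ hω =>
  Finset.sum_congr rfl fun i hi => h i hi hω

theorem IsLocal.bounded [Finite S] {F : Config d S → ℝ} (hF : IsLocal F) :
    ∃ C : ℝ, 0 ≤ C ∧ ∀ ω, |F ω| ≤ C := by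
  rcases isEmpty_or_nonempty (Config d S) with h | ⟨⟨η⟩⟩
  · exact ⟨0, le_rfl, fun ω => h.elim ω⟩
  obtain ⟨Λ, hΛ⟩ := hF
  cases nonempty_fintype S
  obtain ⟨C, hC⟩ := (Set.finite_range fun p : Λ → S => |F (glue Λ p η)|).bddAbove
  refine ⟨max C 0, le_max_right _ _, fun ω => le_max_of_le_left ?_⟩
  rw [← hΛ.apply_glue_restrict ω η]
  exact hC ⟨_, rfl⟩

theorem IsLocal.comp {F : Config d S → ℝ} (hF : IsLocal F) (g : ℝ → ℝ) :
    IsLocal fun ω => g (F ω) := by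
  obtain ⟨Λ, hΛ⟩ := hF
  exact ⟨Λ, fun _ _ h => congrArg g (hΛ h)⟩

theorem measurable_shift [MeasurableSpace S] (x : Site d) : Measurable (shift (S := S) x) :=
  measurable_pi_lambda _ fun _ => measurable_pi_apply _

theorem measurable_glue [MeasurableSpace S] (Λ : Finset (Site d)) (p : Λ → S) :
    Measurable (glue Λ p) := by
  refine measurable_pi_lambda _ fun x => ?_
  by_cases h : x ∈ Λ
  · simp only [glue_of_mem h, measurable_const]
  · simp only [glue_of_notMem h]; exact measurable_pi_apply _

theorem integrable_of_abs_le [MeasurableSpace S] {μ : Measure (Config d S)} [IsFiniteMeasure μ]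
    {F : Config d S → ℝ} (hF : Measurable F) {C : ℝ} (hC : ∀ ω, |F ω| ≤ C) : Integrable F μ :=
  Integrable.of_bound hF.aestronglyMeasurable C (ae_of_all _ hC)

theorem IsShiftInvariant.integral_comp_shift [MeasurableSpace S] {μ : Measure (Config d S)} (hμ : IsShiftInvariant μ)
    {F : Config d S → ℝ} (hF : Measurable F) (x : Site d) :
    ∫ ω, F (shift x ω) ∂μ = ∫ ω, F ω ∂μ := by
  conv_rhs => rw [← hμ.map_shift x]
  rw [integral_map (measurable_shift x).aemeasurable hF.aestronglyMeasurable]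

/-- Two probability measures that give cylinder events the same mass are equal; it suffices to
compare in one direction. -/
theorem measure_eq_of_forall_dependsOn [MeasurableSpace S] {μ ν : Measure (Config d S)} [IsProbabilityMeasure μ]
    [IsProbabilityMeasure ν]
    (h : ∀ E : Set (Config d S), MeasurableSet E →
      (IsLocal (E.indicator fun _ => (1 : ℝ))) → ν.real E ≤ μ.real E) : ν = μ := by
  refine ext_of_generate_finite _ generateFrom_measurableCylinders.symm
    isPiSystem_measurableCylinders (fun E hE => ?_) (by simp)
  obtain ⟨s, T, hT, rfl⟩ := (mem_measurableCylinders E).1 hE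
  have hloc : ∀ T : Set (s → S), IsLocal ((cylinder s T).indicator fun _ => (1 : ℝ)) := by
    refine fun T => ⟨s, fun ω ω' hω => ?_⟩
    have : s.restrict ω = s.restrict ω' := funext fun x => hω x.1 x.2
    have : ω ∈ cylinder s T ↔ ω' ∈ cylinder s T := by rw [mem_cylinder, mem_cylinder, this]
    by_cases h1 : ω ∈ cylinder s T
    · rw [Set.indicator_of_mem h1, Set.indicator_of_mem (this.1 h1)]
    · rw [Set.indicator_of_notMem h1, Set.indicator_of_notMem (mt this.2 h1)]
  have h1 := h _ (MeasurableSet.cylinder s hT) (hloc T)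
  -- The complement of a cylinder is a cylinder; for probability measures this supplies the reverse
  -- inequality.
  have h2 := h _ (MeasurableSet.cylinder s hT.compl) (hloc _)
  rw [← compl_cylinder, probReal_compl_eq_one_sub (MeasurableSet.cylinder s hT),
    probReal_compl_eq_one_sub (MeasurableSet.cylinder s hT)] at h2
  exact (measureReal_eq_measureReal_iff).1 (le_antisymm h1 (by linarith))

variable [Finite S] [MeasurableSpace S] [MeasurableSingletonClass S]

theorem IsLocal.measurable {F : Config d S → ℝ} (hF : IsLocal F) : Measurable F := by
  rcases isEmpty_or_nonempty (Config d S) with h | ⟨⟨η⟩⟩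
  · exact measurable_of_empty _
  obtain ⟨Λ, hΛ⟩ := hF
  have : F = (fun p : Λ → S => F (glue Λ p η)) ∘ Λ.restrict :=
    funext fun ω => (hΛ.apply_glue_restrict ω η).symm
  rw [this]
  exact Measurable.of_discrete.comp (Finset.measurable_restrict Λ)

theorem IsLocal.integrable {F : Config d S → ℝ} (hF : IsLocal F) (μ : Measure (Config d S))
    [IsFiniteMeasure μ] : Integrable F μ :=
  let ⟨_, _, hC⟩ := hF.bounded
  integrable_of_abs_le hF.measurable hC

end Local

namespace Potential

/-! ### Tails of the potential and the influence of the boundary condition -/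

section Tail

variable {d : ℕ} {S : Type*} (Φ : Potential d S)

/-- The supremum norm of `Φ(A, ·)`. -/
noncomputable def supNorm (A : Finset (Site d)) : ℝ := ⨆ ω : Config d S, |Φ.toFun A ω|

theorem supNorm_nonneg (A : Finset (Site d)) : 0 ≤ Φ.supNorm A :=
  Real.iSup_nonneg fun _ => abs_nonneg _

theorem abs_le_supNorm [Finite S] {A : Finset (Site d)} (hA : A.Nonempty) (ω : Config d S) :
    |Φ.toFun A ω| ≤ Φ.supNorm A := by
  obtain ⟨C, -, hC⟩ := IsLocal.bounded ⟨A, Φ.dependsOn A hA⟩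
  exact le_ciSup (f := fun ω => |Φ.toFun A ω|) ⟨C, by rintro _ ⟨ω, rfl⟩; exact hC ω⟩ ω

variable {Φ}

theorem ShiftInvariant.supNorm_map (hinv : Φ.ShiftInvariant) {A : Finset (Site d)}
    (hA : A.Nonempty) (x : Site d) :
    Φ.supNorm (A.map (addRightEmbedding x)) = Φ.supNorm A :=
  ((shift_surjective x).iSup_congr _ fun ω => by rw [hinv A ω x hA]).symm

variable (Φ) in
open Classical in
/-- The total norm of the sets that contain `x` and are not contained in `B`. -/
noncomputable def tail (x : Site d) (B : Set (Site d)) : ℝ :=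
  ∑' A : Finset (Site d), if x ∈ A ∧ ¬ (A : Set (Site d)) ⊆ B then Φ.supNorm A else 0

theorem tsum_translate (f : Finset (Site d) → ℝ) (x : Site d) :
    ∑' A : Finset (Site d), f (A.map (addRightEmbedding x)) = ∑' A, f A :=
  (Equiv.finsetCongr (Equiv.addRight x)).tsum_eq f

theorem summable_translate {f : Finset (Site d) → ℝ} (x : Site d) :
    (Summable fun A : Finset (Site d) => f (A.map (addRightEmbedding x))) ↔ Summable f :=
  (Equiv.finsetCongr (Equiv.addRight x)).summable_iff

theorem summable_supNorm (hinv : Φ.ShiftInvariant) (hsum : Φ.UniformlySummable) (x : Site d) :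
    Summable fun A : Finset (Site d) => if x ∈ A then Φ.supNorm A else 0 := by
  have h0 : Summable fun A : Finset (Site d) => if 0 ∈ A then Φ.supNorm A else 0 := by
    have := (summable_subtype_iff_indicator (f := Φ.supNorm)
      (s := {A : Finset (Site d) | 0 ∈ A})).1 hsum
    refine this.congr fun A => ?_
    simp [Set.indicator]
  refine (summable_translate x).1 (h0.congr fun A => ?_)
  have hx : x ∈ A.map (addRightEmbedding x) ↔ 0 ∈ A := by simp
  simp only [hx]
  split_ifs with h
  · rw [hinv.supNorm_map ⟨0, h⟩]
  · rfl

open Classical in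
theorem summable_tail (hinv : Φ.ShiftInvariant) (hsum : Φ.UniformlySummable) (x : Site d)
    (B : Set (Site d)) : Summable fun A : Finset (Site d) =>
      if x ∈ A ∧ ¬ (A : Set (Site d)) ⊆ B then Φ.supNorm A else 0 := by
  refine (summable_supNorm hinv hsum x).of_nonneg_of_le (fun A => ?_) fun A => ?_
  · split_ifs <;> simp [supNorm_nonneg]
  · by_cases h : x ∈ A <;> by_cases h' : (A : Set (Site d)) ⊆ B <;> simp [h, h', supNorm_nonneg]

/-- Translating by `x` turns the sets containing `0` into those containing `x`, and a translate that
leaves `B` comes from a set that leaves `C`. This makes tail estimates uniform in the site. -/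
theorem tail_le_of_translate_subset (hinv : Φ.ShiftInvariant) (hsum : Φ.UniformlySummable)
    {x : Site d} {B C : Set (Site d)} (h : ∀ y ∈ C, y + x ∈ B) : Φ.tail x B ≤ Φ.tail 0 C := by
  classical
  have hs := (summable_translate x).2 (summable_tail hinv hsum x B)
  refine (tsum_translate _ x).symm.trans_le
    (Summable.tsum_le_tsum (fun A => ?_) hs (summable_tail hinv hsum 0 C))
  have hx : x ∈ A.map (addRightEmbedding x) ↔ 0 ∈ A := by simp
  simp only [hx]
  by_cases h0 : 0 ∈ A
  · rw [hinv.supNorm_map ⟨0, h0⟩]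
    by_cases hC : (A : Set (Site d)) ⊆ C
    · rw [if_neg, if_neg] <;> simp only [not_and, not_not, hC, implies_true]
      intro _ y hy
      simp only [Finset.coe_map, Set.mem_image, addRightEmbedding_apply] at hy
      obtain ⟨z, hz, rfl⟩ := hy
      exact h z (hC hz)
    · rw [if_pos (c := 0 ∈ A ∧ ¬ (A : Set (Site d)) ⊆ C) ⟨h0, hC⟩]
      split_ifs
      · exact le_rfl
      · exact supNorm_nonneg _ _
  · simp [h0]

theorem tail_nonneg (x : Site d) (B : Set (Site d)) : 0 ≤ Φ.tail x B :=
  tsum_nonneg fun A => by split_ifs <;> simp [supNorm_nonneg]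

theorem exists_subset_box (A : Finset (Site d)) : ∃ n : ℕ, A ⊆ box d n := by
  refine ⟨∑ x ∈ A, ∑ i, (x i).natAbs, fun x hx => ?_⟩
  have h (i : Fin d) : (x i).natAbs ≤ ∑ x ∈ A, ∑ i, (x i).natAbs :=
    (Finset.single_le_sum (f := fun i => (x i).natAbs) (fun _ _ => Nat.zero_le _)
      (Finset.mem_univ i)).trans
    (Finset.single_le_sum (f := fun x : Site d => ∑ i, (x i).natAbs)
      (fun _ _ => Nat.zero_le _) hx)
  simp only [box, Finset.mem_Icc, Pi.le_def]
  exact ⟨fun i => by have := h i; omega, fun i => by have := h i; omega⟩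

theorem box_mono {m n : ℕ} (h : m ≤ n) : box d m ⊆ box d n := by
  refine Finset.Icc_subset_Icc (fun i => ?_) (fun i => ?_) <;> simp only <;> omega

/-- Dominated convergence: each finite set eventually lies in the box and drops out of the sum. -/
theorem tendsto_tail_box (hinv : Φ.ShiftInvariant) (hsum : Φ.UniformlySummable) :
    Tendsto (fun n : ℕ => Φ.tail 0 (box d n)) atTop (𝓝 0) := by
  classical
  have := tendsto_tsum_of_dominated_convergence (𝓕 := atTop)
    (f := fun (n : ℕ) (A : Finset (Site d)) =>
      if 0 ∈ A ∧ ¬ (A : Set (Site d)) ⊆ box d n then Φ.supNorm A else 0) (g := fun _ => 0)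
    (summable_supNorm hinv hsum 0) (fun A => ?_) (Eventually.of_forall fun n A => ?_)
  · simpa [tail] using this
  · obtain ⟨N, hN⟩ := exists_subset_box A
    refine tendsto_const_nhds.congr' ((eventually_ge_atTop N).mono fun n hn => ?_)
    have : (A : Set (Site d)) ⊆ box d n := by exact_mod_cast hN.trans (box_mono hn)
    simp [this]
  · by_cases h : 0 ∈ A <;> by_cases h' : (A : Set (Site d)) ⊆ box d n <;>
      simp [h, h', supNorm_nonneg, abs_of_nonneg]

theorem summable_hamiltonian_bound (hinv : Φ.ShiftInvariant) (hsum : Φ.UniformlySummable)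
    (Λ : Finset (Site d)) :
    Summable fun A : {A : Finset (Site d) // (A ∩ Λ).Nonempty} => Φ.supNorm A.1 := by
  have h : Summable fun A : Finset (Site d) => ∑ x ∈ Λ, if x ∈ A then Φ.supNorm A else 0 :=
    summable_sum fun x _ => summable_supNorm hinv hsum x
  refine (h.subtype {A : Finset (Site d) | (A ∩ Λ).Nonempty}).of_nonneg_of_le
    (fun A => supNorm_nonneg _ _) fun A => ?_
  obtain ⟨x, hx⟩ := A.2
  rw [Finset.mem_inter] at hx
  refine le_trans ?_ (Finset.single_le_sum (fun y _ => ?_) hx.2)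
  · simp [hx.1]
  · split_ifs <;> simp [supNorm_nonneg]

variable [Finite S]

theorem summable_hamiltonian (hinv : Φ.ShiftInvariant) (hsum : Φ.UniformlySummable)
    (Λ : Finset (Site d)) (ω : Config d S) :
    Summable fun A : {A : Finset (Site d) // (A ∩ Λ).Nonempty} => Φ.toFun A.1 ω :=
  Summable.of_norm_bounded (summable_hamiltonian_bound hinv hsum Λ) fun A =>
    Φ.abs_le_supNorm (A.2.mono Finset.inter_subset_left) ω

/-- The effect on the energy in `Λ` of changing the boundary condition outside `B`. -/
theorem abs_hamiltonian_sub_le (hinv : Φ.ShiftInvariant) (hsum : Φ.UniformlySummable)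
    (Λ : Finset (Site d)) (p : Λ → S) {η η' : Config d S} {B : Set (Site d)}
    (h : ∀ x ∈ B, x ∉ Λ → η x = η' x) :
    |Φ.hamiltonian Λ p η - Φ.hamiltonian Λ p η'| ≤ 2 * ∑ x ∈ Λ, Φ.tail x B := by
  classical
  unfold hamiltonian
  rw [← (summable_hamiltonian hinv hsum Λ _).tsum_sub (summable_hamiltonian hinv hsum Λ _)]
  -- Interactions inside `B` cancel in the difference, and any other costs at most twice its norm.
  -- `g` counts such a set once for every site of `Λ` it contains, hence at least once.
  let g : Finset (Site d) → ℝ := fun A =>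
    ∑ x ∈ Λ, if x ∈ A ∧ ¬ (A : Set (Site d)) ⊆ B then Φ.supNorm A else 0
  have hg0 : ∀ A, 0 ≤ g A := fun A => Finset.sum_nonneg fun x _ => by
    split_ifs <;> simp [supNorm_nonneg]
  have hg : Summable g := summable_sum fun x _ => summable_tail hinv hsum x B
  have hgs : Summable fun A : {A : Finset (Site d) // (A ∩ Λ).Nonempty} => 2 * g A.1 :=
    (hg.subtype {A : Finset (Site d) | (A ∩ Λ).Nonempty}).mul_left 2
  rw [← Real.norm_eq_abs]
  refine (tsum_of_norm_bounded hgs.hasSum fun A => ?_).trans ?_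
  · have hA := A.2.mono (Finset.inter_subset_left (s₁ := A.1) (s₂ := Λ))
    by_cases hB : (A.1 : Set (Site d)) ⊆ B
    · rw [Φ.dependsOn A.1 hA (x := glue Λ p η) (y := glue Λ p η'), sub_self, norm_zero]
      · exact mul_nonneg zero_le_two (hg0 _)
      · intro x hx
        by_cases hxΛ : x ∈ Λ
        · rw [glue_of_mem hxΛ, glue_of_mem hxΛ]
        · rw [glue_of_notMem hxΛ, glue_of_notMem hxΛ, h x (hB hx) hxΛ]
    · obtain ⟨x, hx⟩ := A.2
      rw [Finset.mem_inter] at hx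
      have h1 : Φ.supNorm A.1 ≤ g A.1 := by
        refine le_trans ?_ (Finset.single_le_sum (fun y _ => ?_) hx.2)
        · rw [if_pos ⟨hx.1, hB⟩]
        · split_ifs <;> simp [supNorm_nonneg]
      have h2 := Φ.abs_le_supNorm hA (glue Λ p η)
      have h3 := Φ.abs_le_supNorm hA (glue Λ p η')
      rw [Real.norm_eq_abs]
      exact (abs_sub _ _).trans (by linarith)
  · rw [tsum_mul_left]
    refine mul_le_mul_of_nonneg_left ((hg.tsum_subtype_le g _ hg0).trans_eq ?_) zero_le_two
    exact Summable.tsum_finsetSum fun x _ => summable_tail hinv hsum x B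

end Tail

end Potential
end LatticeGibbs

namespace LatticeGibbs
namespace Potential

/-! ### The specification as an averaging operator; the DLR equations -/

section GibbsAverage

variable {d : ℕ} {S : Type*} [Fintype S] (Φ : Potential d S)

/-- The average `∑_p γ_Λ(p | η) f(p_Λ η_{Λᶜ})`. -/
noncomputable def gibbsAverage (Λ : Finset (Site d)) (f : Config d S → ℝ) (η : Config d S) : ℝ :=
  ∑ p : Λ → S, Φ.specification Λ p η * f (glue Λ p η)

theorem partitionFunction_pos (Λ : Finset (Site d)) (η : Config d S) :
    0 < Φ.partitionFunction Λ η :=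
  Finset.sum_pos (fun _ _ => Real.exp_pos _) ⟨Λ.restrict η, Finset.mem_univ _⟩

theorem specification_nonneg (Λ : Finset (Site d)) (p : Λ → S) (η : Config d S) :
    0 ≤ Φ.specification Λ p η :=
  div_nonneg (Real.exp_pos _).le (Φ.partitionFunction_pos Λ η).le

theorem sum_specification (Λ : Finset (Site d)) (η : Config d S) :
    ∑ p, Φ.specification Λ p η = 1 := by
  simp only [specification, ← Finset.sum_div]
  exact div_self (Φ.partitionFunction_pos Λ η).ne'

theorem specification_le_one (Λ : Finset (Site d)) (p : Λ → S) (η : Config d S) :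
    Φ.specification Λ p η ≤ 1 := by
  rw [← Φ.sum_specification Λ η]
  exact Finset.single_le_sum (f := fun p => Φ.specification Λ p η)
    (fun q _ => Φ.specification_nonneg Λ q η) (Finset.mem_univ p)

variable {Φ}

theorem gibbsAverage_mono {Λ : Finset (Site d)} {f g : Config d S → ℝ} (h : ∀ ω, f ω ≤ g ω)
    (η : Config d S) : Φ.gibbsAverage Λ f η ≤ Φ.gibbsAverage Λ g η :=
  Finset.sum_le_sum fun p _ =>
    mul_le_mul_of_nonneg_left (h _) (Φ.specification_nonneg Λ p η)

/-- The average behaves as a conditional expectation given the coordinates off `Λ`: factors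
depending on these alone come out. -/
theorem gibbsAverage_mul {Λ : Finset (Site d)} {f g : Config d S → ℝ}
    (hg : DependsOn g (Λ : Set (Site d))ᶜ) (η : Config d S) :
    Φ.gibbsAverage Λ (fun ω => g ω * f ω) η = g η * Φ.gibbsAverage Λ f η := by
  unfold gibbsAverage
  rw [Finset.mul_sum]
  refine Finset.sum_congr rfl fun p _ => ?_
  have hgη : g (glue Λ p η) = g η := hg fun x hx => glue_of_notMem hx
  simp only [hgη]
  ring

theorem gibbsAverage_one (Λ : Finset (Site d)) (η : Config d S) :
    Φ.gibbsAverage Λ (fun _ => 1) η = 1 := by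
  simp [gibbsAverage, sum_specification]

theorem gibbsAverage_add {Λ : Finset (Site d)} (f g : Config d S → ℝ) (η : Config d S) :
    Φ.gibbsAverage Λ (fun ω => f ω + g ω) η = Φ.gibbsAverage Λ f η + Φ.gibbsAverage Λ g η := by
  simp [gibbsAverage, mul_add, Finset.sum_add_distrib]

theorem gibbsAverage_of_dependsOn_compl {Λ : Finset (Site d)} {g : Config d S → ℝ}
    (hg : DependsOn g (Λ : Set (Site d))ᶜ) (η : Config d S) : Φ.gibbsAverage Λ g η = g η := by
  simpa [gibbsAverage_one] using gibbsAverage_mul (Φ := Φ) (f := fun _ => 1) hg η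

theorem abs_gibbsAverage_le {Λ : Finset (Site d)} {f : Config d S → ℝ} {C : ℝ}
    (hC : ∀ ω, |f ω| ≤ C) (η : Config d S) : |Φ.gibbsAverage Λ f η| ≤ C := by
  have h1 := gibbsAverage_mono (Φ := Φ) (Λ := Λ) (fun ω => (abs_le.1 (hC ω)).2) η
  have h2 := gibbsAverage_mono (Φ := Φ) (Λ := Λ) (fun ω => (abs_le.1 (hC ω)).1) η
  have hc (c : ℝ) : Φ.gibbsAverage Λ (fun _ => c) η = c :=
    gibbsAverage_of_dependsOn_compl (fun _ _ _ => rfl) η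
  rw [hc] at h1 h2
  exact abs_le.2 ⟨h2, h1⟩

theorem dependsOn_gibbsAverage (Λ : Finset (Site d)) (f : Config d S → ℝ) :
    DependsOn (Φ.gibbsAverage Λ f) (Λ : Set (Site d))ᶜ := by
  intro η η' h
  have hglue : ∀ p : Λ → S, glue Λ p η = glue Λ p η' := fun p => funext fun x => by
    by_cases hx : x ∈ Λ
    · rw [glue_of_mem hx, glue_of_mem hx]
    · rw [glue_of_notMem hx, glue_of_notMem hx, h x hx]
  simp only [gibbsAverage, specification, partitionFunction, hamiltonian, hglue]

/-- One factor `exp c` comes from the Boltzmann weight, the other from the partition function. -/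
theorem specification_le {Λ : Finset (Site d)} {η η' : Config d S} {c : ℝ}
    (h : ∀ p, |Φ.hamiltonian Λ p η - Φ.hamiltonian Λ p η'| ≤ c) (p : Λ → S) :
    Φ.specification Λ p η ≤ Real.exp (2 * c) * Φ.specification Λ p η' := by
  have hexp : ∀ q, Real.exp (-Φ.hamiltonian Λ q η) ≤ Real.exp c * Real.exp (-Φ.hamiltonian Λ q η') ∧
      Real.exp (-Φ.hamiltonian Λ q η') ≤ Real.exp c * Real.exp (-Φ.hamiltonian Λ q η) := fun q => by
    rw [← Real.exp_add, ← Real.exp_add, Real.exp_le_exp, Real.exp_le_exp]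
    have := abs_le.1 (h q)
    constructor <;> linarith
  have hZ : Φ.partitionFunction Λ η' ≤ Real.exp c * Φ.partitionFunction Λ η := by
    unfold partitionFunction
    rw [Finset.mul_sum]
    exact Finset.sum_le_sum fun q _ => (hexp q).2
  unfold specification
  rw [div_le_iff₀ (Φ.partitionFunction_pos Λ η), mul_assoc, div_mul_eq_mul_div, ← mul_div_assoc,
    le_div_iff₀ (Φ.partitionFunction_pos Λ η'), two_mul, Real.exp_add]
  calc Real.exp (-Φ.hamiltonian Λ p η) * Φ.partitionFunction Λ η'
      ≤ (Real.exp c * Real.exp (-Φ.hamiltonian Λ p η')) * (Real.exp c * Φ.partitionFunction Λ η) :=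
        mul_le_mul (hexp p).1 hZ (Φ.partitionFunction_pos Λ η').le (by positivity)
    _ = _ := by ring

theorem gibbsAverage_le_exp_mul {Λ : Finset (Site d)} {η η' : Config d S} {c : ℝ}
    (h : ∀ p, |Φ.hamiltonian Λ p η - Φ.hamiltonian Λ p η'| ≤ c) {f : Config d S → ℝ}
    (hf : ∀ ω, 0 ≤ f ω) (hff : ∀ p, f (glue Λ p η) = f (glue Λ p η')) :
    Φ.gibbsAverage Λ f η ≤ Real.exp (2 * c) * Φ.gibbsAverage Λ f η' := by
  unfold gibbsAverage
  rw [Finset.mul_sum]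
  refine Finset.sum_le_sum fun p _ => ?_
  rw [hff p, ← mul_assoc]
  exact mul_le_mul_of_nonneg_right (specification_le h p) (hf _)

variable [MeasurableSpace S] [MeasurableSingletonClass S]

theorem measurable_hamiltonian (hinv : Φ.ShiftInvariant) (hsum : Φ.UniformlySummable)
    (Λ : Finset (Site d)) (p : Λ → S) : Measurable (Φ.hamiltonian Λ p) := by
  refine measurable_of_tendsto_metrizable' atTop
    (f := fun (s : Finset {A : Finset (Site d) // (A ∩ Λ).Nonempty}) η =>
      ∑ A ∈ s, Φ.toFun A.1 (glue Λ p η)) (fun s => ?_) ?_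
  · refine Finset.measurable_sum _ fun A _ => ?_
    have hA := A.2.mono (Finset.inter_subset_left (s₁ := A.1) (s₂ := Λ))
    exact (IsLocal.measurable ⟨A.1, Φ.dependsOn A.1 hA⟩).comp (measurable_glue Λ p)
  · exact tendsto_pi_nhds.2 fun η => (summable_hamiltonian hinv hsum Λ (glue Λ p η)).hasSum

theorem measurable_specification (hinv : Φ.ShiftInvariant) (hsum : Φ.UniformlySummable)
    (Λ : Finset (Site d)) (p : Λ → S) : Measurable (Φ.specification Λ p) :=
  (Real.measurable_exp.comp (measurable_hamiltonian hinv hsum Λ p).neg).div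
    (Finset.measurable_sum _ fun q _ =>
      Real.measurable_exp.comp (measurable_hamiltonian hinv hsum Λ q).neg)

theorem measurable_gibbsAverage (hinv : Φ.ShiftInvariant) (hsum : Φ.UniformlySummable)
    (Λ : Finset (Site d)) {f : Config d S → ℝ} (hf : Measurable f) :
    Measurable (Φ.gibbsAverage Λ f) :=
  Finset.measurable_sum _ fun p _ =>
    (measurable_specification hinv hsum Λ p).mul (hf.comp (measurable_glue Λ p))

variable (Φ) in
/-- The measure `μ γ_Λ`: resample the coordinates in `Λ` according to the specification. -/
noncomputable def resample (Λ : Finset (Site d)) (μ : Measure (Config d S)) :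
    Measure (Config d S) :=
  ∑ p : Λ → S, (μ.withDensity fun η => ENNReal.ofReal (Φ.specification Λ p η)).map (glue Λ p)

theorem resample_apply (hinv : Φ.ShiftInvariant) (hsum : Φ.UniformlySummable)
    (Λ : Finset (Site d)) (μ : Measure (Config d S)) {A : Set (Config d S)}
    (hA : MeasurableSet A) :
    Φ.resample Λ μ A = ∫⁻ η, ∑ p : Λ → S, ENNReal.ofReal (Φ.specification Λ p η) *
        A.indicator (fun _ => (1 : ℝ≥0∞)) (glue Λ p η) ∂μ := by
  have hm (p : Λ → S) := (measurable_specification hinv hsum Λ p).ennreal_ofReal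
  have hA' (p : Λ → S) := measurable_glue Λ p hA
  have hi (p : Λ → S) : Measurable fun η => ENNReal.ofReal (Φ.specification Λ p η) *
      A.indicator (fun _ => (1 : ℝ≥0∞)) (glue Λ p η) :=
    (hm p).mul ((measurable_const.indicator hA).comp (measurable_glue Λ p))
  rw [lintegral_finsetSum _ fun p _ => hi p]
  simp only [resample, Measure.coe_finsetSum, Finset.sum_apply]
  refine Finset.sum_congr rfl fun p _ => ?_
  rw [Measure.map_apply (measurable_glue Λ p) hA, withDensity_apply _ (hA' p),
    ← lintegral_indicator (hA' p)]
  refine lintegral_congr fun η => ?_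
  by_cases h : glue Λ p η ∈ A <;> simp [Set.indicator, h]

theorem isGibbs_iff (hinv : Φ.ShiftInvariant) (hsum : Φ.UniformlySummable)
    {μ : Measure (Config d S)} :
    Φ.IsGibbs μ ↔ IsProbabilityMeasure μ ∧ ∀ Λ, Φ.resample Λ μ = μ := by
  constructor
  · rintro ⟨h1, h2⟩
    exact ⟨h1, fun Λ => Measure.ext fun A hA => by
      rw [resample_apply hinv hsum Λ μ hA, h2 Λ A hA]⟩
  · rintro ⟨h1, h2⟩
    exact ⟨h1, fun Λ A hA => by rw [← resample_apply hinv hsum Λ μ hA, h2]⟩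

theorem integral_resample (hinv : Φ.ShiftInvariant) (hsum : Φ.UniformlySummable)
    (Λ : Finset (Site d)) (μ : Measure (Config d S)) [IsFiniteMeasure μ] {f : Config d S → ℝ}
    (hf : Measurable f) {C : ℝ} (hC : ∀ ω, |f ω| ≤ C) :
    ∫ ω, f ω ∂(Φ.resample Λ μ) = ∫ η, Φ.gibbsAverage Λ f η ∂μ := by
  have hm (p : Λ → S) := (measurable_specification hinv hsum Λ p).ennreal_ofReal
  have hfin (p : Λ → S) :
      IsFiniteMeasure (μ.withDensity fun η => ENNReal.ofReal (Φ.specification Λ p η)) :=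
    isFiniteMeasure_withDensity_ofReal
      (integrable_of_abs_le (C := 1) (measurable_specification hinv hsum Λ p) fun η => by
        rw [abs_of_nonneg (Φ.specification_nonneg Λ p η)]
        exact Φ.specification_le_one Λ p η).2
  unfold resample gibbsAverage
  rw [integral_finsetSum_measure fun p _ => integrable_of_abs_le hf hC, integral_finsetSum]
  · refine Finset.sum_congr rfl fun p _ => ?_
    rw [integral_map (measurable_glue Λ p).aemeasurable hf.aestronglyMeasurable,
      integral_withDensity_eq_integral_toReal_smul (hm p) (ae_of_all _ fun _ => by simp)]
    refine integral_congr_ae (ae_of_all _ fun η => ?_)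
    simp [ENNReal.toReal_ofReal (Φ.specification_nonneg Λ p η)]
  · refine fun p _ => integrable_of_abs_le (C := C) ((measurable_specification hinv hsum Λ p).mul
      (hf.comp (measurable_glue Λ p))) fun η => ?_
    rw [abs_mul, abs_of_nonneg (Φ.specification_nonneg Λ p η)]
    have h1 := Φ.specification_le_one Λ p η
    have h2 := hC (glue Λ p η)
    have h3 := Φ.specification_nonneg Λ p η
    have h4 := abs_nonneg (f (glue Λ p η))
    nlinarith

theorem IsGibbs.integral_gibbsAverage (hinv : Φ.ShiftInvariant) (hsum : Φ.UniformlySummable)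
    {μ : Measure (Config d S)} (hμ : Φ.IsGibbs μ) (Λ : Finset (Site d)) {f : Config d S → ℝ}
    (hf : Measurable f) {C : ℝ} (hC : ∀ ω, |f ω| ≤ C) :
    ∫ η, Φ.gibbsAverage Λ f η ∂μ = ∫ ω, f ω ∂μ := by
  have := hμ.isProbabilityMeasure
  rw [← integral_resample hinv hsum Λ μ hf hC, ((isGibbs_iff hinv hsum).1 hμ).2 Λ]

/-- A probability measure is Gibbs as soon as resampling does not decrease the mass of cylinder
events. -/
theorem isGibbs_of_forall_le (hinv : Φ.ShiftInvariant) (hsum : Φ.UniformlySummable)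
    {μ : Measure (Config d S)} [IsProbabilityMeasure μ]
    (h : ∀ (Λ : Finset (Site d)) (E : Set (Config d S)), MeasurableSet E →
      (IsLocal (E.indicator fun _ => (1 : ℝ))) →
        μ.real E ≤ ∫ η, Φ.gibbsAverage Λ (E.indicator fun _ => 1) η ∂μ) : Φ.IsGibbs μ := by
  refine (isGibbs_iff hinv hsum).2 ⟨inferInstance, fun Λ => ?_⟩
  have hE (E : Set (Config d S)) (ω) : |E.indicator (fun _ => (1 : ℝ)) ω| ≤ 1 := by
    by_cases h : ω ∈ E <;> simp [h]
  -- Equality of the total masses is what lets a one-sided comparison on cylinders suffice.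
  have : IsProbabilityMeasure (Φ.resample Λ μ) := ⟨by
    rw [resample_apply hinv hsum Λ μ MeasurableSet.univ]
    simp only [Set.indicator_univ, mul_one]
    rw [← lintegral_one.trans (measure_univ (μ := μ))]
    refine lintegral_congr fun η => ?_
    rw [← ENNReal.ofReal_sum_of_nonneg fun p _ => Φ.specification_nonneg Λ p η,
      Φ.sum_specification, ENNReal.ofReal_one]⟩
  refine (measure_eq_of_forall_dependsOn fun E hEm hEl => ?_).symm
  refine (h Λ E hEm hEl).trans_eq ?_
  rw [← integral_resample hinv hsum Λ μ (measurable_const.indicator hEm) (hE E),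
    integral_indicator_const _ hEm]
  simp

end GibbsAverage

end Potential

/-! ### Lower bounds for relative entropy -/

/-- The Donsker–Varadhan inequality. -/
theorem integral_sub_log_le_klDiv {α : Type*} [MeasurableSpace α] {μ ν : Measure α}
    [IsProbabilityMeasure μ] [IsProbabilityMeasure ν]
    (h : InformationTheory.klDiv ν μ ≠ ⊤) {f : α → ℝ} (hf : Measurable f) {C : ℝ}
    (hC : ∀ x, |f x| ≤ C) :
    ∫ x, f x ∂ν - Real.log (∫ x, Real.exp (f x) ∂μ) ≤
      (InformationTheory.klDiv ν μ).toReal := by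
  obtain ⟨hac, hint⟩ := InformationTheory.klDiv_ne_top_iff.1 h
  have hfν : Integrable f ν := Integrable.of_bound hf.aestronglyMeasurable C (ae_of_all _ hC)
  have hfμ : Integrable (fun x => Real.exp (f x)) μ :=
    Integrable.of_bound (Real.measurable_exp.comp hf).aestronglyMeasurable (Real.exp C)
      (ae_of_all _ fun x => by
        rw [Real.norm_eq_abs, Real.abs_exp]
        exact Real.exp_le_exp.2 (le_of_abs_le (hC x)))
  -- The inequality is nonnegativity of the divergence of `ν` from `μ` tilted by `f`.
  have := isProbabilityMeasure_tilted hfμ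
  have h1 := integral_llr_tilted_right hac hfν hfμ hint
  have h2 := InformationTheory.integral_llr_add_sub_measure_univ_nonneg
    (hac.trans (absolutelyContinuous_tilted hfμ))
    (integrable_llr_tilted_right hac hfν hint hfμ)
  have h3 := InformationTheory.toReal_klDiv hac hint
  simp only [probReal_univ] at h2 h3
  linarith

end LatticeGibbs

namespace LatticeGibbs

section Box

variable {d : ℕ} {S : Type*}

theorem mem_box {n : ℕ} {x : Site d} : x ∈ box d n ↔ ∀ i, -(n : ℤ) ≤ x i ∧ x i ≤ n := by
  simp only [box, Finset.mem_Icc, Pi.le_def, forall_and]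

theorem card_box (n : ℕ) : (box d n).card = (2 * n + 1) ^ d := by
  rw [box, Pi.card_Icc]
  simp only [Int.card_Icc, Finset.prod_const, Finset.card_univ, Fintype.card_fin]
  congr 1; omega

theorem card_box_pos (n : ℕ) : 0 < ((box d n).card : ℝ) := by
  rw [card_box]; positivity

theorem shift_shift (x y : Site d) (ω : Config d S) : shift x (shift y ω) = shift (x + y) ω :=
  funext fun z => by simp only [shift]; congr 1; abel

theorem shift_zero (ω : Config d S) : shift 0 ω = ω := funext fun z => by simp [shift]

/-- Donsker–Varadhan for the marginals on the box: `F` descends to patterns by gluing in an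
arbitrary fixed configuration outside. -/
theorem relEntropy_ge [Finite S] [MeasurableSpace S] [MeasurableSingletonClass S]
    {μ ν : Measure (Config d S)} [IsProbabilityMeasure μ] [IsProbabilityMeasure ν] {n : ℕ}
    (h : relEntropy n ν μ ≠ ⊤) {F : Config d S → ℝ}
    (hF : DependsOn F (box d n : Set (Site d))) :
    ∫ ω, F ω ∂ν - Real.log (∫ ω, Real.exp (F ω) ∂μ) ≤ (relEntropy n ν μ).toReal := by
  obtain ⟨η⟩ : Nonempty (Config d S) := nonempty_of_isProbabilityMeasure ν
  have hr := Finset.measurable_restrict (X := fun _ : Site d => S) (box d n)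
  have := Measure.isProbabilityMeasure_map (μ := μ) hr.aemeasurable
  have := Measure.isProbabilityMeasure_map (μ := ν) hr.aemeasurable
  obtain ⟨C, -, hC⟩ := IsLocal.bounded ⟨_, hF⟩
  have key := integral_sub_log_le_klDiv h (f := fun p => F (glue (box d n) p η))
    Measurable.of_discrete (fun p => hC _)
  rw [integral_map hr.aemeasurable Measurable.of_discrete.aestronglyMeasurable,
    integral_map hr.aemeasurable Measurable.of_discrete.aestronglyMeasurable] at key
  simp only [hF.apply_glue_restrict] at key
  exact key

end Box

/-! ### Zero specific relative entropy implies the DLR equations -/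

namespace Potential

variable {d : ℕ} {S : Type*} {Φ : Potential d S}

theorem tail_le_of_mem_box (hinv : Φ.ShiftInvariant) (hsum : Φ.UniformlySummable) {m n : ℕ}
    {x : Site d} (hx : x ∈ box d m) : Φ.tail x (box d (n + m)) ≤ Φ.tail 0 (box d n) := by
  refine tail_le_of_translate_subset hinv hsum fun y hy => ?_
  rw [Finset.mem_coe, mem_box] at *
  intro i
  have h1 := hx i
  have h2 := hy i
  simp only [Pi.add_apply]
  omega

variable [Fintype S]

/-- Quasilocality of the specification. -/
theorem exists_box_gibbsAverage_le (hinv : Φ.ShiftInvariant) (hsum : Φ.UniformlySummable)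
    (Λ : Finset (Site d)) {f : Config d S → ℝ} (hf : IsLocal f) (hf0 : ∀ ω, 0 ≤ f ω)
    (hf1 : ∀ ω, f ω ≤ 1) {ε : ℝ} (hε : 0 < ε) :
    ∃ K : ℕ, Λ ⊆ box d K ∧ DependsOn f (box d K : Set (Site d)) ∧
      ∀ η η' : Config d S, (∀ x ∈ box d K, η x = η' x) →
        Φ.gibbsAverage Λ f η ≤ Φ.gibbsAverage Λ f η' + ε := by
  obtain ⟨M, hM⟩ := hf
  obtain ⟨m, hm⟩ := exists_subset_box Λ
  obtain ⟨l, hl⟩ := exists_subset_box M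
  -- The inner 2 is from the energy estimate, the outer from numerator and partition function. As
  -- the averages lie in `[0, 1]`, a factor below `1 + ε` is an additive error of at most `ε`.
  have hlim : Tendsto (fun n : ℕ => Real.exp (2 * (2 * (Λ.card * Φ.tail 0 (box d n)))))
      atTop (𝓝 1) := by
    have := ((((tendsto_tail_box hinv hsum).const_mul (Λ.card : ℝ)).const_mul 2).const_mul 2)
    rw [mul_zero, mul_zero, mul_zero] at this
    have h := (Real.continuous_exp.tendsto 0).comp this
    rw [Real.exp_zero] at h
    exact h
  obtain ⟨k, hk, hkl⟩ := ((hlim.eventually (gt_mem_nhds (show (1 : ℝ) < 1 + ε by linarith))).and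
    (eventually_ge_atTop l)).exists
  have hMK : DependsOn f (box d (k + m) : Set (Site d)) :=
    hM.mono (by exact_mod_cast hl.trans (box_mono (by omega)))
  refine ⟨k + m, hm.trans (box_mono (by omega)), hMK, fun η η' h => ?_⟩
  have hH (p : Λ → S) : |Φ.hamiltonian Λ p η - Φ.hamiltonian Λ p η'| ≤
      2 * (Λ.card * Φ.tail 0 (box d k)) := by
    refine (abs_hamiltonian_sub_le hinv hsum Λ p (B := box d (k + m))
      fun x hx _ => h x hx).trans (mul_le_mul_of_nonneg_left ?_ zero_le_two)
    rw [← nsmul_eq_mul]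
    exact Finset.sum_le_card_nsmul _ _ _ fun x hx => tail_le_of_mem_box hinv hsum (hm hx)
  have h1 := gibbsAverage_le_exp_mul hH hf0 fun p => hMK fun x hx => glue_congr (h x hx)
  have h2 := abs_le.1 (abs_gibbsAverage_le (Φ := Φ) (Λ := Λ) (f := f) (C := 1)
    (fun ω => abs_le.2 ⟨by linarith [hf0 ω], hf1 ω⟩) η')
  have h3 : 0 ≤ Φ.gibbsAverage Λ f η' :=
    Finset.sum_nonneg fun p _ => mul_nonneg (Φ.specification_nonneg Λ p η') (hf0 _)
  nlinarith

variable [MeasurableSpace S] [MeasurableSingletonClass S]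

/-- Exponential moments of a sum over well separated translates, by successive resampling. -/
theorem IsGibbs.integral_exp_sum_le (hinv : Φ.ShiftInvariant) (hsum : Φ.UniformlySummable)
    {μ : Measure (Config d S)} (hμ : Φ.IsGibbs μ) (hμ' : IsShiftInvariant μ)
    {Λ : Finset (Site d)} {K : ℕ} (hΛ : Λ ⊆ box d K) {φ : Config d S → ℝ}
    (hφ : DependsOn φ (box d K : Set (Site d))) {b : ℝ}
    (hb : ∀ η, Φ.gibbsAverage Λ (fun ω => Real.exp (φ ω)) η ≤ Real.exp b)
    (Z : Finset (Site d)) :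
    ∫ ω, Real.exp (∑ z ∈ Z, φ (shift (-((2 * K + 1 : ℤ) • z)) ω)) ∂μ ≤
      Real.exp (Z.card * b) := by
  classical
  have := hμ.isProbabilityMeasure
  obtain ⟨C, hC0, hC⟩ := IsLocal.bounded ⟨_, hφ⟩
  have hφm : Measurable φ := IsLocal.measurable ⟨_, hφ⟩
  induction Z using Finset.induction_on with
  | empty => simp
  | insert z Z hz ih =>
    set x : Site d := (2 * K + 1 : ℤ) • z with hx
    set G : Config d S → ℝ := fun ω =>
      Real.exp (∑ w ∈ Z, φ (shift (-((2 * K + 1 : ℤ) • w)) ω)) with hG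
    have hGm : Measurable G := Real.measurable_exp.comp
      (Finset.measurable_sum _ fun w _ => hφm.comp (measurable_shift _))
    have hexpm : Measurable fun ω => Real.exp (φ ω) := Real.measurable_exp.comp hφm
    have hGC (ω : Config d S) : G ω ≤ Real.exp (Z.card * C) := by
      refine Real.exp_le_exp.2 ?_
      rw [← nsmul_eq_mul]
      exact Finset.sum_le_card_nsmul _ _ _ fun w _ => (abs_le.1 (hC _)).2
    -- Shifting by `x` moves the block of `z` to the origin. The other blocks are translates of `box
    -- d K` by nonzero multiples of `2K + 1`, so they miss `box d K` and hence `Λ`; resampling in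
    -- `Λ` leaves their factor alone.
    have hGd : DependsOn (fun ω => G (shift x ω)) (Λ : Set (Site d))ᶜ := by
      intro ω ω' hω
      simp only [hG, shift_shift]
      congr 1
      refine Finset.sum_congr rfl fun w hw => ?_
      have hne : z ≠ w := fun h => hz (h ▸ hw)
      obtain ⟨i, hi⟩ := Function.ne_iff.1 hne
      refine hφ fun y hy => hω _ fun hmem => ?_
      have h1 := mem_box.1 hy i
      have h2 := mem_box.1 (hΛ hmem) i
      simp only [Pi.sub_apply, Pi.add_apply, Pi.neg_apply, hx, Pi.smul_apply, smul_eq_mul] at h2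
      rcases lt_or_gt_of_ne hi with h | h
      · nlinarith
      · nlinarith
    calc ∫ ω, Real.exp (∑ w ∈ insert z Z, φ (shift (-((2 * K + 1 : ℤ) • w)) ω)) ∂μ
        = ∫ ω, G ω * Real.exp (φ (shift (-x) ω)) ∂μ := by
          refine integral_congr_ae (ae_of_all _ fun ω => ?_)
          simp only [Finset.sum_insert hz, Real.exp_add, hG]
          exact mul_comm _ _
      _ = ∫ ω, G (shift x ω) * Real.exp (φ ω) ∂μ := by
          have hm : Measurable fun ω => G ω * Real.exp (φ (shift (-x) ω)) :=
            hGm.mul (hexpm.comp (measurable_shift _))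
          rw [← hμ'.integral_comp_shift hm x]
          simp only [shift_shift (-x), neg_add_cancel, shift_zero]
      _ = ∫ η, G (shift x η) * Φ.gibbsAverage Λ (fun ω => Real.exp (φ ω)) η ∂μ := by
          have hm : Measurable fun ω => G (shift x ω) * Real.exp (φ ω) :=
            (hGm.comp (measurable_shift x)).mul hexpm
          rw [← hμ.integral_gibbsAverage hinv hsum Λ hm
            (C := Real.exp (Z.card * C) * Real.exp C) fun ω => ?_]
          · refine integral_congr_ae (ae_of_all _ fun η => ?_)
            exact gibbsAverage_mul hGd η
          · rw [abs_of_nonneg (mul_nonneg (Real.exp_pos _).le (Real.exp_pos _).le)]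
            exact mul_le_mul (hGC _) (Real.exp_le_exp.2 (abs_le.1 (hC ω)).2)
              (Real.exp_pos _).le (Real.exp_pos _).le
      _ ≤ ∫ η, G (shift x η) * Real.exp b ∂μ := by
          have hGi : ∀ ω, |G (shift x ω)| ≤ Real.exp (Z.card * C) := fun ω => by
            rw [abs_of_nonneg (Real.exp_pos _).le]; exact hGC _
          have hGi' : Integrable (fun η => G (shift x η)) μ :=
            integrable_of_abs_le (hGm.comp (measurable_shift x)) hGi
          refine integral_mono ?_ (hGi'.mul_const _)
            fun η => mul_le_mul_of_nonneg_left (hb η) (Real.exp_pos _).le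
          refine integrable_of_abs_le (C := Real.exp (Z.card * C) * Real.exp C)
            ((hGm.comp (measurable_shift x)).mul
            (measurable_gibbsAverage hinv hsum Λ hexpm)) fun η => ?_
          rw [abs_mul]
          refine mul_le_mul (hGi _) (abs_gibbsAverage_le (fun ω => ?_) η) (abs_nonneg _)
            (Real.exp_pos _).le
          rw [Real.abs_exp]
          exact Real.exp_le_exp.2 (abs_le.1 (hC ω)).2
      _ = (∫ η, G η ∂μ) * Real.exp b := by
          rw [integral_mul_const, hμ'.integral_comp_shift hGm x]
      _ ≤ Real.exp (Z.card * b) * Real.exp b :=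
          mul_le_mul_of_nonneg_right ih (Real.exp_pos _).le
      _ = _ := by
          rw [← Real.exp_add, Finset.card_insert_of_notMem hz]
          congr 1; push_cast; ring

/-- A shift-invariant measure of zero specific relative entropy with respect to a shift-invariant
Gibbs measure is a Gibbs measure. -/
theorem IsGibbs.of_hasSpecificRelEntropy_zero (hinv : Φ.ShiftInvariant)
    (hsum : Φ.UniformlySummable) {μ ν : Measure (Config d S)} (hμ : Φ.IsGibbs μ)
    (hμ' : IsShiftInvariant μ) (hν : IsShiftInvariant ν) (h : HasSpecificRelEntropy ν μ 0) :
    Φ.IsGibbs ν := by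
  have := hμ.isProbabilityMeasure
  have := hν.isProbabilityMeasure
  obtain ⟨η₀⟩ : Nonempty (Config d S) := nonempty_of_isProbabilityMeasure ν
  refine isGibbs_of_forall_le hinv hsum fun Λ E hE hEl => ?_
  set f : Config d S → ℝ := E.indicator fun _ => 1 with hf
  have hf0 (ω) : 0 ≤ f ω := Set.indicator_nonneg (fun _ _ => zero_le_one) ω
  have hf1 (ω) : f ω ≤ 1 := Set.indicator_le_self' (fun _ _ => zero_le_one) ω
  have hfν : ∫ ω, f ω ∂ν = ν.real E := by rw [hf, integral_indicator_const _ hE]; simp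
  set u : Config d S → ℝ := Φ.gibbsAverage Λ f with hu
  have hum : Measurable u := measurable_gibbsAverage hinv hsum Λ hEl.measurable
  have hu0 (ω) : 0 ≤ u ω :=
    Finset.sum_nonneg fun p _ => mul_nonneg (Φ.specification_nonneg Λ p ω) (hf0 _)
  have hu1 (ω) : u ω ≤ 1 := le_of_abs_le (abs_gibbsAverage_le
    (fun ω => abs_le.2 ⟨by linarith [hf0 ω], hf1 ω⟩) ω)
  have hui : Integrable u ν := integrable_of_abs_le (C := 1) hum
    fun ω => abs_le.2 ⟨by linarith [hu0 ω], hu1 ω⟩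
  by_contra! hlt
  obtain ⟨a, ha⟩ : ∃ a, a = ν.real E - ∫ η, u η ∂ν := ⟨_, rfl⟩
  have ha0 : 0 < a := by linarith
  have ha1 : a ≤ 1 := by
    have := measureReal_le_one (μ := ν) (s := E)
    have := integral_nonneg (μ := ν) (f := u) hu0
    linarith
  obtain ⟨K, hΛK, hfK, hK⟩ := exists_box_gibbsAverage_le hinv hsum Λ hEl hf0 hf1
    (show 0 < a / 4 by linarith)
  -- Freezing the coordinates off the box makes `u ∘ r` local, and it stays within `a / 4` of `u` by
  -- quasilocality. So `φ` is a local version of `f - u`.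
  set r : Config d S → Config d S := fun η => glue (box d K) ((box d K).restrict η) η₀ with hr
  have hrK (η : Config d S) : ∀ x ∈ box d K, r η x = η x := fun x hx => glue_of_mem hx
  have hrK' (η : Config d S) : ∀ x ∉ box d K, r η x = η₀ x := fun x hx => glue_of_notMem hx
  set φ : Config d S → ℝ := fun η => f η - u (r η) with hφ
  have hrd : DependsOn (fun η => u (r η)) (box d K : Set (Site d)) := fun η η' hη => by
    have : r η = r η' := funext fun x => by
      by_cases hx : x ∈ box d K
      · rw [hrK η x hx, hrK η' x hx, hη x hx]
      · rw [hrK' η x hx, hrK' η' x hx]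
    simp only [this]
  have hrΛ : DependsOn (fun η => u (r η)) (Λ : Set (Site d))ᶜ := fun η η' hη =>
    dependsOn_gibbsAverage Λ f fun x hx => by
      by_cases hxK : x ∈ box d K
      · rw [hrK η x hxK, hrK η' x hxK, hη x hx]
      · rw [hrK' η x hxK, hrK' η' x hxK]
  have hφd : DependsOn φ (box d K : Set (Site d)) := fun η η' hη => by
    simp only [hφ]; rw [hfK hη]; congr 1; exact hrd hη
  have hφ1 (ω) : |φ ω| ≤ 1 := abs_le.2
    ⟨by linarith [hf0 ω, hu1 (r ω)], by linarith [hf1 ω, hu0 (r ω)]⟩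
  have hφν : a - a / 4 ≤ ∫ ω, φ ω ∂ν := by
    have h1 : Integrable (fun ω => u (r ω)) ν := IsLocal.integrable ⟨_, hrd⟩ ν
    have h2 : ∫ ω, u (r ω) ∂ν ≤ ∫ ω, (u ω + a / 4) ∂ν :=
      integral_mono h1 (hui.add (integrable_const _)) fun ω => hK _ _ (hrK ω)
    rw [integral_add hui (integrable_const _)] at h2
    simp only [integral_const, probReal_univ, one_smul] at h2
    rw [hφ, integral_sub (hEl.integrable ν) h1, hfν]
    linarith
  -- The parameter of the exponential moment is `s = a / 4`. Given the outside of `Λ`, `φ` has mean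
  -- at most `a / 4`, and `exp y ≤ 1 + y + y²` for `|y| ≤ 1` yields the exponent `s * (a / 4) + s²`.
  have hb (η) : Φ.gibbsAverage Λ (fun ω => Real.exp (a / 4 * φ ω)) η ≤
      Real.exp (a / 4 * (a / 4) + (a / 4) ^ 2) := by
    have h1 (ω : Config d S) : Real.exp (a / 4 * φ ω) ≤
        (1 + (a / 4) ^ 2 - a / 4 * u (r ω)) + a / 4 * f ω := by
      have hle : |a / 4 * φ ω| ≤ a / 4 := by
        rw [abs_mul, abs_of_pos (by linarith)]
        exact mul_le_of_le_one_right (by linarith) (hφ1 ω)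
      have h2 := (abs_le.1 (Real.abs_exp_sub_one_sub_id_le (hle.trans (by linarith)))).2
      have h3 : (a / 4 * φ ω) ^ 2 ≤ (a / 4) ^ 2 := sq_le_sq.2 (by
        rwa [abs_of_pos (show 0 < a / 4 by linarith)])
      have h4 : a / 4 * φ ω = a / 4 * f ω - a / 4 * u (r ω) := by simp only [hφ]; ring
      linarith
    refine (gibbsAverage_mono h1 η).trans ?_
    rw [gibbsAverage_add, gibbsAverage_mul (g := fun _ => a / 4) (fun _ _ _ => rfl),
      gibbsAverage_of_dependsOn_compl fun ω ω' hω => by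
        have := hrΛ hω
        simp only at this ⊢
        rw [this]]
    have h5 : u η ≤ u (r η) + a / 4 := hK _ _ fun x hx => (hrK η x hx).symm
    refine le_trans ?_ (Real.add_one_le_exp _)
    change _ + a / 4 * u η ≤ _
    nlinarith
  -- The box of radius `(2K + 1) m + K` is tiled by `(2m + 1) ^ d` translates of `box d K`.
  have hN (m : ℕ) : (2 * ((2 * K + 1) * m + K) + 1) ^ d = (2 * K + 1) ^ d * (2 * m + 1) ^ d := by
    rw [← mul_pow]; congr 1; ring
  -- Each block contributes at least `(a / 4) * (3a / 4)` to the mean under `ν` and at most `a² / 8`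
  -- to the log-moment under `μ`; the difference is `a² / 16`.
  have hbound (m : ℕ) (hfin : relEntropy ((2 * K + 1) * m + K) ν μ ≠ ⊤) :
      ((2 * m + 1) ^ d : ℕ) * (a ^ 2 / 16) ≤ (relEntropy ((2 * K + 1) * m + K) ν μ).toReal := by
    set F : Config d S → ℝ := fun ω =>
      ∑ z ∈ box d m, a / 4 * φ (shift (-((2 * K + 1 : ℤ) • z)) ω) with hF
    have hφd' : DependsOn (fun ω => a / 4 * φ ω) (box d K : Set (Site d)) := fun _ _ hω => by
      simp only [hφd hω]
    have hFd : DependsOn F (box d ((2 * K + 1) * m + K) : Set (Site d)) := by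
      refine DependsOn.finset_sum fun z hz => hφd'.comp_shift _ fun y hy => ?_
      rw [Finset.mem_coe, mem_box] at *
      intro i
      have h1 := hz i
      have h2 := hy i
      simp only [Pi.sub_apply, Pi.neg_apply, Pi.smul_apply, smul_eq_mul]
      push_cast
      constructor <;> nlinarith
    have h1 := relEntropy_ge hfin hFd
    have h2 := hμ.integral_exp_sum_le hinv hsum hμ' hΛK hφd' hb (box d m)
    have h3 : Real.log (∫ ω, Real.exp (F ω) ∂μ) ≤
        (box d m).card * (a / 4 * (a / 4) + (a / 4) ^ 2) := by
      refine (Real.log_le_iff_le_exp ?_).2 h2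
      exact integral_exp_pos ((IsLocal.comp ⟨_, hFd⟩ Real.exp).integrable μ)
    have h4 : ∫ ω, F ω ∂ν = (box d m).card * (a / 4 * ∫ ω, φ ω ∂ν) := by
      have hφm : Measurable φ := IsLocal.measurable ⟨_, hφd⟩
      rw [hF, integral_finsetSum _ fun z _ => ?_]
      · simp only [integral_const_mul, hν.integral_comp_shift hφm, Finset.sum_const, nsmul_eq_mul]
      · exact (integrable_of_abs_le (hφm.comp (measurable_shift _)) fun ω => hφ1 _).const_mul _
    rw [← card_box]
    have h5 := card_box_pos (d := d) m
    have h6 : ((box d m).card : ℝ) * (a / 4 * (a - a / 4)) ≤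
        (box d m).card * (a / 4 * ∫ ω, φ ω ∂ν) := by gcongr
    nlinarith
  -- Half the density just obtained, so that an eventual strict upper bound contradicts it.
  have hpos : 0 < a ^ 2 / 32 / (2 * K + 1) ^ d := by positivity
  obtain ⟨n₀, hn₀⟩ := eventually_atTop.1 (h.eventually (gt_mem_nhds (ENNReal.ofReal_pos.2 hpos)))
  have hm := hn₀ ((2 * K + 1) * n₀ + K) (by nlinarith)
  have hcard : (((2 * ((2 * K + 1) * n₀ + K) + 1) ^ d : ℕ) : ℝ≥0∞) ≠ 0 := by positivity
  rw [ENNReal.div_lt_iff (Or.inl hcard) (Or.inl (ENNReal.natCast_ne_top _))] at hm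
  have hfin := hm.ne_top
  have h1 := hbound n₀ hfin
  have h2 := (ENNReal.toReal_lt_toReal hfin (ENNReal.mul_ne_top ENNReal.ofReal_ne_top
    (ENNReal.natCast_ne_top _))).2 hm
  rw [ENNReal.toReal_mul, ENNReal.toReal_ofReal hpos.le, ENNReal.toReal_natCast, hN] at h2
  have h3 : a ^ 2 / 32 / (2 * K + 1) ^ d * (((2 * K + 1) ^ d * (2 * n₀ + 1) ^ d : ℕ) : ℝ) =
      ((2 * n₀ + 1) ^ d : ℕ) * (a ^ 2 / 32) := by
    push_cast; field_simp
  rw [h3] at h2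
  have h4 : (0 : ℝ) < ((2 * n₀ + 1) ^ d : ℕ) := by positivity
  nlinarith

end Potential
end LatticeGibbs

/-! ### Comparison of Gibbs measures up to boundary terms -/

namespace LatticeGibbs
namespace Potential

variable {d : ℕ} {S : Type*} {Φ : Potential d S}

theorem tendsto_card_box_ratio (R : ℕ) :
    Tendsto (fun k : ℕ => ((box d k).card : ℝ) / (box d (k + R)).card) atTop (𝓝 1) := by
  have h1 : Tendsto (fun k : ℕ => 1 - 2 * (R : ℝ) / ((k + R : ℕ) * 2 + 1 : ℝ)) atTop (𝓝 1) := by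
    have h2 : Tendsto (fun k : ℕ => ((k + R : ℕ) * 2 + 1 : ℝ)) atTop atTop :=
      tendsto_atTop_add_const_right _ _ ((tendsto_natCast_atTop_atTop.comp
        (tendsto_add_atTop_nat R)).atTop_mul_const two_pos)
    simpa using (h2.const_div_atTop (2 * (R : ℝ))).const_sub 1
  have h3 := h1.pow d
  rw [one_pow] at h3
  refine h3.congr fun k => ?_
  rw [card_box, card_box]
  push_cast
  rw [← div_pow]
  congr 1
  field_simp
  ring

/-- Boundary terms are negligible with respect to the volume. -/
theorem eventually_sum_tail_box_le (hinv : Φ.ShiftInvariant) (hsum : Φ.UniformlySummable)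
    {ε : ℝ} (hε : 0 < ε) :
    ∀ᶠ n in atTop, ∑ x ∈ box d n, Φ.tail x (box d n) ≤ ε * (box d n).card := by
  -- Sites of `box d k` are deep inside `box d (k + R)` and have tail below `ε / 2`. The remaining
  -- shell has vanishing proportion, and each of its sites costs at most the full norm `T`.
  obtain ⟨R, hR⟩ := ((tendsto_tail_box hinv hsum).eventually
    (gt_mem_nhds (half_pos hε))).exists
  set T := Φ.tail 0 ∅ with hT
  have hT0 : 0 ≤ T := tail_nonneg _ _
  have hlim : Tendsto (fun k : ℕ => ε / 2 +
      (1 - ((box d k).card : ℝ) / (box d (k + R)).card) * T) atTop (𝓝 (ε / 2)) := by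
    simpa using (((tendsto_card_box_ratio (d := d) R).const_sub 1).mul_const T).const_add (ε / 2)
  have hev := hlim.eventually (gt_mem_nhds (half_lt_self hε))
  rw [← map_add_atTop_eq_nat R, eventually_map]
  filter_upwards [hev] with k hk
  have hsub : box d k ⊆ box d (k + R) := box_mono (by omega)
  have hV := card_box_pos (d := d) (k + R)
  have h1 : ∑ x ∈ box d k, Φ.tail x (box d (k + R)) ≤ (box d k).card * (ε / 2) := by
    rw [← nsmul_eq_mul]
    refine Finset.sum_le_card_nsmul _ _ _ fun x hx => ?_
    rw [add_comm k R]
    exact (tail_le_of_mem_box hinv hsum hx).trans hR.le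
  have h2 : ∑ x ∈ box d (k + R) \ box d k, Φ.tail x (box d (k + R)) ≤
      (box d (k + R) \ box d k).card * T := by
    rw [← nsmul_eq_mul]
    exact Finset.sum_le_card_nsmul _ _ _ fun x hx =>
      tail_le_of_translate_subset hinv hsum fun y hy => hy.elim
  have h3 : ((box d (k + R) \ box d k).card : ℝ) = (box d (k + R)).card - (box d k).card := by
    rw [Finset.card_sdiff_of_subset hsub, Nat.cast_sub (Finset.card_le_card hsub)]
  have h4 : ((box d k).card : ℝ) ≤ (box d (k + R)).card := by
    exact_mod_cast Finset.card_le_card hsub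
  rw [h3] at h2
  rw [← Finset.sum_sdiff hsub]
  have h5 := mul_le_mul_of_nonneg_right hk.le hV.le
  have h6 : (ε / 2 + (1 - ((box d k).card : ℝ) / (box d (k + R)).card) * T) *
      (box d (k + R)).card = ε / 2 * (box d (k + R)).card +
        ((box d (k + R)).card - (box d k).card) * T := by
    field_simp
  nlinarith

variable [Fintype S] [MeasurableSpace S] [MeasurableSingletonClass S]

/-- Two Gibbs measures are comparable in a box up to a boundary term. -/
theorem IsGibbs.integral_le_exp_mul (hinv : Φ.ShiftInvariant) (hsum : Φ.UniformlySummable)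
    {μ ν : Measure (Config d S)} (hμ : Φ.IsGibbs μ) (hν : Φ.IsGibbs ν) {Λ : Finset (Site d)}
    {f : Config d S → ℝ} (hf : DependsOn f (Λ : Set (Site d))) (hf0 : ∀ ω, 0 ≤ f ω) :
    ∫ ω, f ω ∂ν ≤ Real.exp (4 * ∑ x ∈ Λ, Φ.tail x Λ) * ∫ ω, f ω ∂μ := by
  have := hμ.isProbabilityMeasure
  have := hν.isProbabilityMeasure
  have hfm : Measurable f := IsLocal.measurable ⟨_, hf⟩
  obtain ⟨C, -, hC⟩ := IsLocal.bounded ⟨_, hf⟩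
  have hi (ρ : Measure (Config d S)) [IsProbabilityMeasure ρ] :
      Integrable (Φ.gibbsAverage Λ f) ρ :=
    integrable_of_abs_le (measurable_gibbsAverage hinv hsum Λ hfm) (abs_gibbsAverage_le hC)
  -- The boundary conditions are arbitrary and independent of each other, so `η` can be integrated
  -- against `ν` and `η'` against `μ`.
  have h1 (η η' : Config d S) : Φ.gibbsAverage Λ f η ≤
      Real.exp (4 * ∑ x ∈ Λ, Φ.tail x Λ) * Φ.gibbsAverage Λ f η' := by
    have := gibbsAverage_le_exp_mul (Φ := Φ) (η := η) (η' := η')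
      (fun p => abs_hamiltonian_sub_le hinv hsum Λ p (B := Λ) fun x hx hx' => (hx' hx).elim)
      hf0 fun p => hf.comp_glue_eq p η η'
    convert this using 3
    ring
  have h2 (η' : Config d S) : ∫ ω, f ω ∂ν ≤
      Real.exp (4 * ∑ x ∈ Λ, Φ.tail x Λ) * Φ.gibbsAverage Λ f η' := by
    rw [← hν.integral_gibbsAverage hinv hsum Λ hfm hC]
    have := integral_mono (hi ν) (integrable_const _) fun η => h1 η η'
    simpa using this
  have h3 := integral_mono (integrable_const _) ((hi μ).const_mul _) h2
  rw [integral_const_mul, hμ.integral_gibbsAverage hinv hsum Λ hfm hC] at h3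
  simpa using h3

end Potential

/-! ### Oscillations of sums of translates -/

section Oscillation

variable {d : ℕ} {S : Type*}

theorem oscillation_nonneg (F : Config d S → ℝ) (x : Site d) : 0 ≤ oscillation F x :=
  Real.sSup_nonneg (by rintro _ ⟨ω, ω', -, rfl⟩; exact abs_nonneg _)

theorem oscillation_le {F : Config d S → ℝ} {x : Site d} {c : ℝ} (hc : 0 ≤ c)
    (h : ∀ ω ω' : Config d S, (∀ y, y ≠ x → ω y = ω' y) → |F ω - F ω'| ≤ c) :
    oscillation F x ≤ c :=
  Real.sSup_le (by rintro _ ⟨ω, ω', hω, rfl⟩; exact h ω ω' hω) hc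

theorem oscillation_eq_zero {F : Config d S → ℝ} {M : Set (Site d)} (hF : DependsOn F M)
    {x : Site d} (hx : x ∉ M) : oscillation F x = 0 :=
  le_antisymm (oscillation_le le_rfl fun ω ω' h => by
    rw [hF fun y hy => h y fun hyx => hx (hyx ▸ hy), sub_self, abs_zero]) (oscillation_nonneg F x)

/-- Changing the site `x` affects only the translates with `x - z ∈ M`, at most `M.card` of them
whatever the size of `Z`. -/
theorem oscillation_sum_translates_le {f : Config d S → ℝ} {M : Finset (Site d)}
    (hf : DependsOn f (M : Set (Site d))) (hf1 : ∀ ω ω', |f ω - f ω'| ≤ 1) {t : ℝ} (ht : 0 ≤ t)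
    (Z : Finset (Site d)) (x : Site d) :
    oscillation (fun ω => t * ∑ z ∈ Z, f (shift (-z) ω)) x ≤ t * M.card := by
  classical
  refine oscillation_le (by positivity) fun ω ω' h => ?_
  rw [← mul_sub, abs_mul, abs_of_nonneg ht, ← Finset.sum_sub_distrib]
  refine mul_le_mul_of_nonneg_left ((Finset.abs_sum_le_sum_abs _ _).trans ?_) ht
  have h1 : ∀ z ∈ Z, |f (shift (-z) ω) - f (shift (-z) ω')| ≤ if x - z ∈ M then 1 else 0 := by
    intro z _
    split_ifs with hz
    · exact hf1 _ _
    · rw [hf (x := shift (-z) ω) (y := shift (-z) ω'), sub_self, abs_zero]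
      intro y hy
      refine h _ fun hyx => hz ?_
      rw [← hyx]
      simpa using hy
  refine (Finset.sum_le_sum h1).trans ?_
  rw [← Finset.sum_filter, Finset.sum_const, nsmul_one]
  exact_mod_cast Finset.card_le_card_of_injOn (fun z => x - z)
    (fun z hz => (Finset.mem_filter.1 hz).2) (fun z _ w _ hzw => sub_right_injective hzw)

end Oscillation

/-! ### Uniqueness from Gaussian concentration -/

namespace Potential

variable {d : ℕ} {S : Type*} {Φ : Potential d S} [Fintype S] [MeasurableSpace S]

theorem IsGibbs.isEquilibriumState {μ : Measure (Config d S)} (hμ : Φ.IsGibbs μ)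
    (hμ' : IsShiftInvariant μ) : Φ.IsEquilibriumState μ := by
  have := hμ.isProbabilityMeasure
  refine ⟨hμ', μ, hμ, hμ', tendsto_const_nhds.congr fun n => ?_⟩
  have := Measure.isProbabilityMeasure_map (μ := μ)
    (Finset.measurable_restrict (X := fun _ : Site d => S) (box d n)).aemeasurable
  rw [relEntropy, InformationTheory.klDiv_self, ENNReal.zero_div]

variable [MeasurableSingletonClass S]

/-- A shift-invariant Gibbs measure with Gaussian concentration is the only shift-invariant Gibbs
measure. -/
theorem IsGibbs.eq_of_gcb (hinv : Φ.ShiftInvariant) (hsum : Φ.UniformlySummable)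
    {μ ν : Measure (Config d S)} (hμ : Φ.IsGibbs μ) (hν : Φ.IsGibbs ν)
    (hμ' : IsShiftInvariant μ) (hν' : IsShiftInvariant ν) (hgcb : GCB μ) : ν = μ := by
  have := hμ.isProbabilityMeasure
  have := hν.isProbabilityMeasure
  obtain ⟨D, hD, hgcb⟩ := hgcb
  refine measure_eq_of_forall_dependsOn fun E hE hEl => ?_
  set f : Config d S → ℝ := E.indicator fun _ => 1 with hf
  have hf0 (ω) : 0 ≤ f ω := Set.indicator_nonneg (fun _ _ => zero_le_one) ω
  have hf1 (ω) : f ω ≤ 1 := Set.indicator_le_self' (fun _ _ => zero_le_one) ω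
  have hfi (ρ : Measure (Config d S)) [IsProbabilityMeasure ρ] : ∫ ω, f ω ∂ρ = ρ.real E := by
    rw [hf, integral_indicator_const _ hE]; simp
  obtain ⟨M, hM⟩ := id hEl
  obtain ⟨r, hr⟩ := exists_subset_box M
  have hfr : DependsOn f (box d r : Set (Site d)) := hM.mono (by exact_mod_cast hr)
  by_contra! hlt
  obtain ⟨a, ha⟩ : ∃ a, a = ν.real E - μ.real E := ⟨_, rfl⟩
  have ha0 : 0 < a := by linarith
  set R : ℝ := ((box d r).card : ℝ) with hR
  have hR0 : 0 < R := card_box_pos r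
  -- Chosen so that the concentration cost per site, `D * (t * R)²`, equals `t * a / 8`. The
  -- boundary cost below is `4 * (t * a / 32)`, again `t * a / 8`.
  set t : ℝ := a / (8 * D * R ^ 2) with ht
  have ht0 : 0 < t := by positivity
  have hε : 0 < t * a / 32 := by positivity
  have hratio := (tendsto_card_box_ratio (d := d) r).eventually
    (lt_mem_nhds (show (1 / 2 : ℝ) < 1 by norm_num))
  obtain ⟨m, hm1, hm2⟩ := (((tendsto_add_atTop_nat r).eventually
    (eventually_sum_tail_box_le hinv hsum hε)).and hratio).exists
  have hV := card_box_pos (d := d) (m + r)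
  have hN := card_box_pos (d := d) m
  rw [lt_div_iff₀ hV] at hm2
  set F : Config d S → ℝ := fun ω => t * ∑ z ∈ box d m, f (shift (-z) ω) with hF
  have hFd : DependsOn F (box d (m + r) : Set (Site d)) := by
    have h1 : DependsOn (fun ω => ∑ z ∈ box d m, f (shift (-z) ω))
        (box d (m + r) : Set (Site d)) := by
      refine DependsOn.finset_sum fun z hz => hfr.comp_shift _ fun y hy => ?_
      rw [Finset.mem_coe, mem_box] at *
      intro i
      have h1 := hz i
      have h2 := hy i
      simp only [Pi.sub_apply, Pi.neg_apply]
      omega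
    intro ω ω' hω
    simp only [hF, h1 hω]
  have hFl : IsLocal F := ⟨_, hFd⟩
  have hFint (ρ : Measure (Config d S)) [IsProbabilityMeasure ρ] (hρ : IsShiftInvariant ρ) :
      ∫ ω, F ω ∂ρ = t * ((box d m).card * ρ.real E) := by
    rw [hF, integral_const_mul, integral_finsetSum]
    · simp only [hρ.integral_comp_shift hEl.measurable, hfi, Finset.sum_const, nsmul_eq_mul]
    · exact fun z _ => integrable_of_abs_le (C := 1)
        (hEl.measurable.comp (measurable_shift _))
        fun ω => abs_le.2 ⟨by linarith [hf0 (shift (-z) ω)], hf1 _⟩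
  have hosc : ∑' x, oscillation F x ^ 2 ≤ (box d (m + r)).card * (t * R) ^ 2 := by
    rw [tsum_eq_sum (s := box d (m + r)) fun x hx => by
      rw [oscillation_eq_zero hFd hx]; simp, ← nsmul_eq_mul]
    refine Finset.sum_le_card_nsmul _ _ _ fun x _ => ?_
    refine pow_le_pow_left₀ (oscillation_nonneg F x) ?_ 2
    exact oscillation_sum_translates_le hfr (fun ω ω' => abs_le.2
      ⟨by linarith [hf0 ω, hf1 ω'], by linarith [hf0 ω', hf1 ω]⟩) ht0.le _ x
  -- The chain is Jensen for `ν`, comparison of `ν` with `μ` on the box, then GCB for `μ`.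
  have h1 : Real.exp (∫ ω, F ω ∂ν) ≤ ∫ ω, Real.exp (F ω) ∂ν :=
    convexOn_exp.map_integral_le Real.continuous_exp.continuousOn isClosed_univ
      (ae_of_all _ fun _ => Set.mem_univ _) (hFl.integrable ν)
      ((hFl.comp Real.exp).integrable ν)
  have h2 := hμ.integral_le_exp_mul hinv hsum hν (f := fun ω => Real.exp (F ω))
    (fun _ _ hω => congrArg Real.exp (hFd hω)) fun ω => (Real.exp_pos _).le
  have h3 : ∫ ω, Real.exp (F ω) ∂μ ≤ Real.exp (∫ ω, F ω ∂μ) *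
      Real.exp (D * ∑' x, oscillation F x ^ 2) := by
    have := mul_le_mul_of_nonneg_left (hgcb F hFl) (Real.exp_pos (∫ ω, F ω ∂μ)).le
    rw [← integral_const_mul] at this
    refine le_trans (le_of_eq ?_) this
    refine integral_congr_ae (ae_of_all _ fun ω => ?_)
    simp only [← Real.exp_add]
    congr 1; ring
  have h4 := (h1.trans h2).trans (mul_le_mul_of_nonneg_left h3 (Real.exp_pos _).le)
  rw [← Real.exp_add, ← Real.exp_add, Real.exp_le_exp, hFint ν hν', hFint μ hμ'] at h4
  have h5 := mul_le_mul_of_nonneg_left hosc hD.le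
  have h6 : D * (((box d (m + r)).card : ℝ) * (t * R) ^ 2) =
      t * a / 8 * (box d (m + r)).card := by
    rw [ht]; field_simp
  -- The two costs total `t * a / 4` per site of the larger box, whereas the smaller box holds more
  -- than half of its sites: a contradiction.
  have h7 : t * a * (box d m).card ≤ t * a / 4 * (box d (m + r)).card := by
    have : t * a * (box d m).card = t * ((box d m).card * ν.real E) -
        t * ((box d m).card * μ.real E) := by rw [ha]; ring
    linarith
  have h8 := mul_lt_mul_of_pos_left hm2 (mul_pos ht0 ha0)
  have h9 : 0 < t * a * (box d (m + r)).card := by positivity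
  linarith

theorem IsEquilibriumState.isGibbs (hinv : Φ.ShiftInvariant) (hsum : Φ.UniformlySummable)
    {ν : Measure (Config d S)} (hν : Φ.IsEquilibriumState ν) : Φ.IsGibbs ν :=
  let ⟨hν', _, hμ, hμ', h⟩ := hν
  hμ.of_hasSpecificRelEntropy_zero hinv hsum hμ' hν' h

end Potential

end LatticeGibbs

theorem mainTheorem1 {d : ℕ} (hd : 1 ≤ d) {S : Type*} [Fintype S] [MeasurableSpace S]
    [MeasurableSingletonClass S] (Φ : LatticeGibbs.Potential d S)
    (hinv : Φ.ShiftInvariant) (hsum : Φ.UniformlySummable) :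
    (2 ≤ Φ.ergodicGibbs.encard → ∀ μ ∈ Φ.ergodicGibbs, ¬ LatticeGibbs.GCB μ) ∧
    (2 ≤ Φ.ergodicEquilibriumStates.encard →
      ∀ μ ∈ Φ.ergodicEquilibriumStates, ¬ LatticeGibbs.GCB μ) ∧
    (∀ μ ∈ Φ.ergodicEquilibriumStates, LatticeGibbs.GCB μ → Φ.equilibriumStates = {μ}) := by
  have h3 : ∀ μ ∈ Φ.ergodicEquilibriumStates, LatticeGibbs.GCB μ →
      Φ.equilibriumStates = {μ} := fun μ hμ hgcb =>
    Set.eq_singleton_iff_unique_mem.2 ⟨hμ.1, fun ν hν =>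
      (hμ.1.isGibbs hinv hsum).eq_of_gcb hinv hsum (hν.isGibbs hinv hsum) hμ.1.1 hν.1 hgcb⟩
  have h2 : 2 ≤ Φ.ergodicEquilibriumStates.encard →
      ∀ μ ∈ Φ.ergodicEquilibriumStates, ¬ LatticeGibbs.GCB μ := by
    intro hcard μ hμ hgcb
    have hsub : Φ.ergodicEquilibriumStates ⊆ {μ} := fun ν hν => by
      rw [← h3 μ hμ hgcb]
      exact hν.1
    have h := hcard.trans (Set.encard_le_encard hsub)
    rw [Set.encard_singleton] at h
    exact absurd h (by norm_num)
  have hsub : Φ.ergodicGibbs ⊆ Φ.ergodicEquilibriumStates := fun μ hμ =>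
    ⟨hμ.1.isEquilibriumState hμ.2.isShiftInvariant, hμ.2⟩
  exact ⟨fun hcard μ hμ => h2 (hcard.trans (Set.encard_le_encard hsub)) μ (hsub hμ), h2, h3⟩
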